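/- Let $R,V,T$ be complex $L\times L$ matrices with $R$ and $T$ invertible. For $E\in\mathbb{C}$ let $$ \mathcal{T}^E=\begin{pmatrix}(E\,\mathbf{1}-V)T^{-1} & -R\\ T^{-1} & 0\end{pmatrix}\in\mathbb{C}^{2L\times 2L} $$ be the transfer matrix, with eigenvalues $z_1(E),\dots,z_{2L}(E)$ listed with algebraic multiplicity and ordered so that $|z_1(E)|\le\dots\le|z_{2L}(E)|$, and set $$ \Lambda=\big\{E\in\mathbb{C}\,:\,|z_L(E)|=|z_{L+1}(E)|\big\}. $$ For $s>0$ let $H^{s,R}$ be the rescaled half-line block Toeplitz operator, that is, the bounded operator on $\ell^2(\mathbb{N},\mathbb{C}^L)$ given by $$ (H^{s,R}\psi)_n=s^{-1}R\,\psi_{n-1}+V\psi_n+s\,T\,\psi_{n+1},\qquad n\ge 1,\quad \psi_0:=0. $$ If $L=1$ (so that $R,V,T\in\mathbb{C}$ with $R,T\neq 0$), then $$ \Lambda=\bigcap_{s>0}\mathrm{spec}(H^{s,R}). $$ -/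

import Mathlib

open Polynomial

noncomputable section

namespace BlockToeplitz

/-- The Hilbert space `ℓ²(ℕ, ℂ^L)`. The sites of the half-line are numbered `0, 1, 2, …`. -/
abbrev HalfLine (L : ℕ) : Type := lp (fun _ : ℕ => EuclideanSpace ℂ (Fin L)) 2

/-- The action on sequences of the half-infinite block tridiagonal matrix with `V` on the diagonal,
`T` on the first upper diagonal and `R` on the first lower diagonal:
`(H ψ)_n = R ψ_{n-1} + V ψ_n + T ψ_{n+1}`, the first summand being absent at the boundary site. -/
def halfLineAction {L : ℕ} (R V T : Matrix (Fin L) (Fin L) ℂ)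
    (ψ : ℕ → EuclideanSpace ℂ (Fin L)) : ℕ → EuclideanSpace ℂ (Fin L)
  | 0 => Matrix.toEuclideanCLM (𝕜 := ℂ) V (ψ 0) + Matrix.toEuclideanCLM (𝕜 := ℂ) T (ψ 1)
  | n + 1 => Matrix.toEuclideanCLM (𝕜 := ℂ) R (ψ n) + Matrix.toEuclideanCLM (𝕜 := ℂ) V (ψ (n + 1))
      + Matrix.toEuclideanCLM (𝕜 := ℂ) T (ψ (n + 2))

theorem memℓp_two_iff {L : ℕ} (f : ℕ → EuclideanSpace ℂ (Fin L)) :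
    Memℓp f 2 ↔ Summable fun n => ‖f n‖ ^ 2 := by
  rw [memℓp_gen_iff (by simp)]
  simp

theorem memℓp_clm {L : ℕ} (A : EuclideanSpace ℂ (Fin L) →L[ℂ] EuclideanSpace ℂ (Fin L))
    {f : ℕ → EuclideanSpace ℂ (Fin L)} (hf : Memℓp f 2) : Memℓp (fun n => A (f n)) 2 := by
  rw [memℓp_two_iff] at hf ⊢
  refine Summable.of_nonneg_of_le (fun n => by positivity) (fun n => ?_) (hf.mul_left (‖A‖ ^ 2))
  rw [← mul_pow]
  exact pow_le_pow_left₀ (norm_nonneg _) (A.le_opNorm _) 2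

theorem memℓp_succ_iff {L : ℕ} (f : ℕ → EuclideanSpace ℂ (Fin L)) :
    Memℓp (fun n => f (n + 1)) 2 ↔ Memℓp f 2 := by
  rw [memℓp_two_iff, memℓp_two_iff]
  exact summable_nat_add_iff (f := fun n => ‖f n‖ ^ 2) 1

theorem memℓp_halfLineAction {L : ℕ} (R V T : Matrix (Fin L) (Fin L) ℂ)
    {ψ : ℕ → EuclideanSpace ℂ (Fin L)} (hψ : Memℓp ψ 2) :
    Memℓp (halfLineAction R V T ψ) 2 := by
  rw [← memℓp_succ_iff]
  have h1 : Memℓp (fun n => ψ (n + 1)) 2 := (memℓp_succ_iff ψ).2 hψ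
  have h2 : Memℓp (fun n => ψ (n + 2)) 2 := (memℓp_succ_iff fun n => ψ (n + 1)).2 h1
  exact ((memℓp_clm (Matrix.toEuclideanCLM (𝕜 := ℂ) R) hψ).add
    (memℓp_clm (Matrix.toEuclideanCLM (𝕜 := ℂ) V) h1)).add
    (memℓp_clm (Matrix.toEuclideanCLM (𝕜 := ℂ) T) h2)

def halfLineLinearMap {L : ℕ} (R V T : Matrix (Fin L) (Fin L) ℂ) :
    HalfLine L →ₗ[ℂ] HalfLine L where
  toFun ψ := ⟨halfLineAction R V T ψ, memℓp_halfLineAction R V T (lp.memℓp ψ)⟩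
  map_add' φ ψ := by
    ext1
    funext n
    change halfLineAction R V T (φ + ψ : HalfLine L) n =
      halfLineAction R V T φ n + halfLineAction R V T ψ n
    cases n with
    | zero => simp only [halfLineAction, lp.coeFn_add, Pi.add_apply, map_add]; abel
    | succ n => simp only [halfLineAction, lp.coeFn_add, Pi.add_apply, map_add]; abel
  map_smul' c ψ := by
    ext1
    funext n
    change halfLineAction R V T (c • ψ : HalfLine L) n = c • halfLineAction R V T ψ n
    cases n with
    | zero => simp [halfLineAction]
    | succ n => simp [halfLineAction]

theorem continuous_halfLineLinearMap {L : ℕ} (R V T : Matrix (Fin L) (Fin L) ℂ) :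
    Continuous (halfLineLinearMap R V T) := by
  refine (halfLineLinearMap R V T).continuous_of_seq_closed_graph fun u x y hu hy => ?_
  have ev : ∀ {v : ℕ → HalfLine L} {w : HalfLine L}, Filter.Tendsto v Filter.atTop (nhds w) →
      ∀ n, Filter.Tendsto (fun k => v k n) Filter.atTop (nhds (w n)) := fun {v w} h n =>
    ((lp.evalCLM ℂ (fun _ : ℕ => EuclideanSpace ℂ (Fin L)) 2 n).continuous.tendsto w).comp h
  have cl : ∀ (A : Matrix (Fin L) (Fin L) ℂ) (n : ℕ),
      Filter.Tendsto (fun k => Matrix.toEuclideanCLM (𝕜 := ℂ) A (u k n)) Filter.atTop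
        (nhds (Matrix.toEuclideanCLM (𝕜 := ℂ) A (x n))) := fun A n =>
    ((Matrix.toEuclideanCLM (𝕜 := ℂ) A).continuous.tendsto (x n)).comp (ev hu n)
  ext1
  funext n
  refine tendsto_nhds_unique (ev hy n) ?_
  cases n with
  | zero => exact (cl V 0).add (cl T 1)
  | succ n => exact ((cl R n).add (cl V (n + 1))).add (cl T (n + 2))

/-- The half-line block Toeplitz operator `H^R` with blocks `R`, `V`, `T`, as a bounded operator on
`ℓ²(ℕ, ℂ^L)`. -/
def halfLineToeplitz {L : ℕ} (R V T : Matrix (Fin L) (Fin L) ℂ) : HalfLine L →L[ℂ] HalfLine L :=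
  ⟨halfLineLinearMap R V T, continuous_halfLineLinearMap R V T⟩

/-- The rescaled half-line operator `H^{s,R}`: it has blocks `s⁻¹ R`, `V`, `s T`. -/
def scaledHalfLineToeplitz {L : ℕ} (R V T : Matrix (Fin L) (Fin L) ℂ) (s : ℝ) :
    HalfLine L →L[ℂ] HalfLine L :=
  halfLineToeplitz ((s : ℂ)⁻¹ • R) V ((s : ℂ) • T)

/-- The `2L × 2L` transfer matrix at energy `E`. -/
def transferMatrix {L : ℕ} (R V T : Matrix (Fin L) (Fin L) ℂ) (E : ℂ) :
    Matrix (Fin L ⊕ Fin L) (Fin L ⊕ Fin L) ℂ :=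
  Matrix.fromBlocks ((E • (1 : Matrix (Fin L) (Fin L) ℂ) - V) * T⁻¹) (-R) T⁻¹ 0

/-- `z` lists the eigenvalues of the transfer matrix at energy `E`, repeated according to their
algebraic multiplicity and ordered by increasing modulus. -/
def IsOrderedEigenvalueList {L : ℕ} (R V T : Matrix (Fin L) (Fin L) ℂ) (E : ℂ)
    (z : Fin (2 * L) → ℂ) : Prop :=
  (transferMatrix R V T E).charpoly = ∏ i, (X - C (z i)) ∧ Monotone fun i => ‖z i‖

/-- The set `Λ` of energies at which the middle two eigenvalues `z_L`, `z_{L+1}` of the transfer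
matrix have the same modulus; they carry the indices `L - 1` and `L` since `Fin (2 * L)` starts
at `0`. The moduli do not depend on the choice of the ordered list. -/
def middleModulusSet {L : ℕ} [NeZero L] (R V T : Matrix (Fin L) (Fin L) ℂ) : Set ℂ :=
  {E | ∃ z : Fin (2 * L) → ℂ, IsOrderedEigenvalueList R V T E z ∧
    ‖z ⟨L - 1, by have := NeZero.pos L; omega⟩‖ = ‖z ⟨L, by have := NeZero.pos L; omega⟩‖}

end BlockToeplitz

end

/-!
For `L = 1`, with scalar blocks `r, v, t`, the transfer matrix at energy `E` has characteristic
polynomial `X² - ((E - v) / t) X + r / t`, so its eigenvalues `z, w` are fixed by `z + w = (E - v) / t` and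
`z w = r / t`. Let `A` be the forward and `B` the backward shift on `ℓ²(ℕ)`: both are contractions
and `B A = 1`, while `B` is not invertible. Then
`H^s - E = s t (B - (z/s + w/s) + (z/s)(w/s) A)`, and the pencil in the brackets factors in two ways:
`(B - z/s)(1 - (w/s) A)` and `B (1 - (z/s) A)(1 - (w/s) A)`.

* If `|w| < s < |z|`, both factors of the first form are invertible by a Neumann series, so `E` is
  outside the spectrum of `H^s` (`isUnit_shiftPencil`).
* If `|z| = |w|`, the pencil is invertible for no `s` (`not_isUnit_shiftPencil`). Let `q` be the
  common modulus of `z/s` and `w/s`. For `q < 1`, the factors of the second form other than `B` are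
  invertible, so that invertibility of the pencil would make `B` invertible. For `q > 1`, both
  `B - z/s` and `B - w/s = B (1 - (w/s) A)` are invertible; invertibility of the pencil would pass
  to `1 - (w/s) A` and from there to `B`. The case `q = 1` is a limit of the case `q < 1`, and the
  set of non-invertible operators is closed.

Hence `E` avoids the spectrum of some `H^s` exactly when `|z| ≠ |w|`.
-/

open Polynomial

namespace BlockToeplitz

/-! ### A pencil of a left-invertible contraction and its left inverse -/

section Pencil

variable {𝒜 : Type*} [NormedRing 𝒜] [NormedAlgebra ℂ 𝒜]

/-- The element `b - (z + w) + z w a`; for `b a = 1` it equals `(b - z) (1 - w a)`. -/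
def shiftPencil (a b : 𝒜) (z w : ℂ) : 𝒜 := b - (z + w) • 1 + (z * w) • a

theorem shiftPencil_comm (a b : 𝒜) (z w : ℂ) : shiftPencil a b z w = shiftPencil a b w z := by
  rw [shiftPencil, shiftPencil, add_comm z, mul_comm z]

theorem shiftPencil_eq_mul {a b : 𝒜} (hba : b * a = 1) (z w : ℂ) :
    shiftPencil a b z w = (b - z • 1) * (1 - w • a) := by
  simp only [shiftPencil, mul_sub, sub_mul, mul_one, mul_smul_comm, smul_mul_assoc, hba, one_mul]
  module

/-- Combined with `shiftPencil_eq_mul`, this exhibits the pencil as `b` times two perturbations of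
`1`; in the other direction it recovers `b` from `1 - z a` when `b - z` is invertible. -/
theorem sub_smul_one_eq_mul {a b : 𝒜} (hba : b * a = 1) (z : ℂ) :
    b - z • 1 = b * (1 - z • a) := by
  simp only [mul_sub, mul_one, mul_smul_comm, hba]

variable [CompleteSpace 𝒜]

theorem isUnit_one_sub_smul {a : 𝒜} (ha : ‖a‖ ≤ 1) {w : ℂ} (hw : ‖w‖ < 1) :
    IsUnit (1 - w • a) := by
  refine isUnit_one_sub_of_norm_lt_one ?_
  rw [norm_smul]
  exact (mul_le_of_le_one_right (norm_nonneg w) ha).trans_lt hw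

theorem isUnit_sub_smul_one {b : 𝒜} (hb : ‖b‖ ≤ 1) {z : ℂ} (hz : 1 < ‖z‖) :
    IsUnit (b - z • 1) := by
  have hz0 : z ≠ 0 := norm_pos_iff.1 (one_pos.trans hz)
  have h : IsUnit (1 - z⁻¹ • b) :=
    isUnit_one_sub_smul hb (by rw [norm_inv]; exact inv_lt_one_of_one_lt₀ hz)
  have e : b - z • 1 = Units.mk0 (-z) (neg_ne_zero.2 hz0) • (1 - z⁻¹ • b) := by
    rw [Units.smul_mk0, smul_sub, smul_smul, neg_mul, mul_inv_cancel₀ hz0]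
    module
  rw [e]
  exact h.smul _

theorem isUnit_shiftPencil {a b : 𝒜} (hba : b * a = 1) (ha : ‖a‖ ≤ 1) (hb : ‖b‖ ≤ 1) {z w : ℂ}
    (hz : 1 < ‖z‖) (hw : ‖w‖ < 1) : IsUnit (shiftPencil a b z w) := by
  rw [shiftPencil_eq_mul hba]
  exact (isUnit_sub_smul_one hb hz).mul (isUnit_one_sub_smul ha hw)

theorem not_isUnit_shiftPencil_of_lt_one {a b : 𝒜} (hba : b * a = 1) (ha : ‖a‖ ≤ 1)
    (hb' : ¬IsUnit b) {z w : ℂ} (hz : ‖z‖ < 1) (hw : ‖w‖ < 1) :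
    ¬IsUnit (shiftPencil a b z w) := by
  rw [shiftPencil_eq_mul hba, sub_smul_one_eq_mul hba,
    (isUnit_one_sub_smul ha hw).mul_right_iff, (isUnit_one_sub_smul ha hz).mul_right_iff]
  exact hb'

/-- If the pencil were invertible, so would be its factor `1 - w a`, and hence
`b = (b - w) (1 - w a)⁻¹`. -/
theorem not_isUnit_shiftPencil_of_one_lt {a b : 𝒜} (hba : b * a = 1) (hb : ‖b‖ ≤ 1)
    (hb' : ¬IsUnit b) {z w : ℂ} (hz : 1 < ‖z‖) (hw : 1 < ‖w‖) :
    ¬IsUnit (shiftPencil a b z w) := by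
  rw [shiftPencil_eq_mul hba, (isUnit_sub_smul_one hb hz).mul_left_iff]
  intro h
  have h' := isUnit_sub_smul_one hb hw
  rw [sub_smul_one_eq_mul hba, h.mul_right_iff] at h'
  exact hb' h'

theorem not_isUnit_shiftPencil {a b : 𝒜} (hba : b * a = 1) (ha : ‖a‖ ≤ 1) (hb : ‖b‖ ≤ 1)
    (hb' : ¬IsUnit b) {z w : ℂ} (hzw : ‖z‖ = ‖w‖) : ¬IsUnit (shiftPencil a b z w) := by
  rcases lt_trichotomy ‖z‖ 1 with hz | hz | hz
  · exact not_isUnit_shiftPencil_of_lt_one hba ha hb' hz (hzw ▸ hz)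
  · -- On the unit circle, the pencil is the limit `x → 1` of the pencils at `x z`, `x w`.
    have hcont : Continuous fun x : ℝ => shiftPencil a b (x * z) (x * w) := by
      unfold shiftPencil
      fun_prop
    have hclosed : IsClosed ((fun x : ℝ => shiftPencil a b (x * z) (x * w)) ⁻¹' nonunits 𝒜) :=
      nonunits.isClosed.preimage hcont
    have hsub : Set.Ico (0 : ℝ) 1 ⊆
        (fun x : ℝ => shiftPencil a b (x * z) (x * w)) ⁻¹' nonunits 𝒜 := by
      intro x hx
      have hx' : ‖(x : ℂ)‖ < 1 := by
        rw [Complex.norm_real, Real.norm_of_nonneg hx.1]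
        exact hx.2
      exact not_isUnit_shiftPencil_of_lt_one hba ha hb'
        (by rwa [norm_mul, hz, mul_one]) (by rwa [norm_mul, ← hzw, hz, mul_one])
    have h1 : (1 : ℝ) ∈ closure (Set.Ico (0 : ℝ) 1) := by
      rw [closure_Ico zero_ne_one]
      exact ⟨zero_le_one, le_rfl⟩
    simpa using closure_minimal hsub hclosed h1
  · exact not_isUnit_shiftPencil_of_one_lt hba hb hb' hz (hzw ▸ hz)

end Pencil

/-! ### The shifts on the half-line -/

section Shifts

variable {L : ℕ}

theorem norm_sq_eq_tsum (ψ : HalfLine L) : ‖ψ‖ ^ 2 = ∑' n, ‖ψ n‖ ^ 2 := by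
  simpa using lp.norm_rpow_eq_tsum (p := 2) (by simp) ψ

theorem summable_norm_sq (ψ : HalfLine L) : Summable fun n => ‖ψ n‖ ^ 2 :=
  (memℓp_two_iff _).1 (lp.memℓp ψ)

/-- The forward shift `(A ψ)_{n+1} = ψ_n`, `(A ψ)_0 = 0`. -/
noncomputable def forwardShift (L : ℕ) : HalfLine L →L[ℂ] HalfLine L := halfLineToeplitz 1 0 0

/-- The backward shift `(B ψ)_n = ψ_{n+1}`. -/
noncomputable def backwardShift (L : ℕ) : HalfLine L →L[ℂ] HalfLine L := halfLineToeplitz 0 0 1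

@[simp]
theorem halfLineToeplitz_apply (R V T : Matrix (Fin L) (Fin L) ℂ) (ψ : HalfLine L) (n : ℕ) :
    halfLineToeplitz R V T ψ n = halfLineAction R V T ψ n := rfl

@[simp]
theorem forwardShift_apply_zero (ψ : HalfLine L) : forwardShift L ψ 0 = 0 := by
  simp [forwardShift, halfLineAction]

@[simp]
theorem forwardShift_apply_succ (ψ : HalfLine L) (n : ℕ) : forwardShift L ψ (n + 1) = ψ n := by
  simp [forwardShift, halfLineAction]

@[simp]
theorem backwardShift_apply (ψ : HalfLine L) (n : ℕ) : backwardShift L ψ n = ψ (n + 1) := by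
  cases n <;> simp [backwardShift, halfLineAction]

theorem backwardShift_mul_forwardShift : backwardShift L * forwardShift L = 1 := by
  ext1 ψ
  ext1
  funext n
  simp

theorem norm_forwardShift_le : ‖forwardShift L‖ ≤ 1 := by
  refine ContinuousLinearMap.opNorm_le_bound _ zero_le_one fun ψ => ?_
  rw [one_mul, ← sq_le_sq₀ (norm_nonneg _) (norm_nonneg _), norm_sq_eq_tsum, norm_sq_eq_tsum,
    (summable_norm_sq _).tsum_eq_zero_add]
  simp

theorem norm_backwardShift_le : ‖backwardShift L‖ ≤ 1 := by
  refine ContinuousLinearMap.opNorm_le_bound _ zero_le_one fun ψ => ?_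
  rw [one_mul, ← sq_le_sq₀ (norm_nonneg _) (norm_nonneg _), norm_sq_eq_tsum, norm_sq_eq_tsum,
    (summable_norm_sq ψ).tsum_eq_zero_add]
  simp

theorem not_isUnit_backwardShift [NeZero L] : ¬IsUnit (backwardShift L) := by
  intro h
  -- If `B` were invertible, its right inverse `A` would be a left inverse too; but `A B` kills the
  -- sequences supported at the boundary site.
  have hAB : forwardShift L * backwardShift L = 1 := by
    obtain ⟨u, hu⟩ := h
    have hA : forwardShift L = ↑u⁻¹ := by
      rw [← Units.mul_right_inj u, Units.mul_inv, hu, backwardShift_mul_forwardShift]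
    rw [hA, ← hu, Units.inv_mul]
  let e : EuclideanSpace ℂ (Fin L) := EuclideanSpace.single 0 1
  have h0 := congrArg (fun S : HalfLine L →L[ℂ] HalfLine L => S (lp.single 2 0 e) 0) hAB
  have h1 : (0 : EuclideanSpace ℂ (Fin L)) = e := by simpa using h0
  simpa [e] using congrArg (fun x : EuclideanSpace ℂ (Fin L) => x 0) h1

end Shifts

/-! ### The scalar case -/

section Scalar

variable {R V T : Matrix (Fin 1) (Fin 1) ℂ}

theorem charpoly_transferMatrix (E : ℂ) :
    (transferMatrix R V T E).charpoly =
      X ^ 2 - C ((E - V 0 0) / T 0 0) * X + C (R 0 0 / T 0 0) := by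
  rw [Matrix.charpoly_of_card_eq_two _ (by simp), ← Matrix.det_reindex_self finSumFinEquiv,
    Matrix.det_fin_two]
  have h0 : (finSumFinEquiv (m := 1) (n := 1)).symm 0 = Sum.inl 0 := rfl
  have h1 : (finSumFinEquiv (m := 1) (n := 1)).symm 1 = Sum.inr 0 := rfl
  simp [transferMatrix, Matrix.trace, Matrix.mul_apply, div_eq_mul_inv, h0, h1]

theorem charpoly_transferMatrix_eq_iff (E z w : ℂ) :
    (transferMatrix R V T E).charpoly = (X - C z) * (X - C w) ↔
      z + w = (E - V 0 0) / T 0 0 ∧ z * w = R 0 0 / T 0 0 := by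
  rw [charpoly_transferMatrix]
  have e : (X - C z) * (X - C w) = X ^ 2 - C (z + w) * X + C (z * w) := by
    simp only [C_add, C_mul]
    ring
  rw [e]
  constructor
  · intro h
    have h0 := congrArg (fun p => p.coeff 0) h
    have h1 := congrArg (fun p => p.coeff 1) h
    simp [coeff_X, coeff_C] at h0 h1
    exact ⟨by linear_combination h1, h0.symm⟩
  · rintro ⟨h1, h2⟩
    rw [h1, h2]

theorem exists_charpoly_transferMatrix_eq (E : ℂ) : ∃ z w : ℂ, ‖z‖ ≤ ‖w‖ ∧
    (transferMatrix R V T E).charpoly = (X - C z) * (X - C w) := by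
  set p := (transferMatrix R V T E).charpoly with hp
  have hcard : Multiset.card p.roots = 2 := by
    rw [← (IsAlgClosed.splits p).natDegree_eq_card_roots, hp, Matrix.charpoly_natDegree_eq_dim]
    simp
  obtain ⟨z, w, hzw⟩ := Multiset.card_eq_two.1 hcard
  have hprod : p = (X - C z) * (X - C w) := by
    have h := (IsAlgClosed.splits p).eq_prod_roots_of_monic (Matrix.charpoly_monic _)
    rw [hzw] at h
    simpa using h
  rcases le_total ‖z‖ ‖w‖ with h | h
  · exact ⟨z, w, h, hprod⟩
  · exact ⟨w, z, h, hprod.trans (mul_comm _ _)⟩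

theorem mem_middleModulusSet_iff (E : ℂ) : E ∈ middleModulusSet R V T ↔ ∃ z w : ℂ, ‖z‖ = ‖w‖ ∧
    (transferMatrix R V T E).charpoly = (X - C z) * (X - C w) := by
  constructor
  · rintro ⟨z, ⟨hz, -⟩, h⟩
    exact ⟨z 0, z 1, h, hz.trans (Fin.prod_univ_two _)⟩
  · rintro ⟨z, w, h, hp⟩
    refine ⟨![z, w], ⟨hp.trans (Fin.prod_univ_two (fun i : Fin 2 => X - C (![z, w] i))).symm, ?_⟩, h⟩
    have hc : ∀ i : Fin 2, ‖![z, w] i‖ = ‖w‖ := by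
      intro i
      fin_cases i
      · exact h
      · rfl
    intro i j _
    exact ((hc i).trans (hc j).symm).le

theorem toEuclideanCLM_fin_one (M : Matrix (Fin 1) (Fin 1) ℂ) (x : EuclideanSpace ℂ (Fin 1)) :
    Matrix.toEuclideanCLM (𝕜 := ℂ) M x = M 0 0 • x := by
  ext i
  fin_cases i
  simp [Matrix.ofLp_toEuclideanCLM, Matrix.mulVec, dotProduct]

theorem scaledHalfLineToeplitz_eq (s : ℝ) : scaledHalfLineToeplitz R V T s =
    ((s : ℂ)⁻¹ * R 0 0) • forwardShift 1 + V 0 0 • 1 + ((s : ℂ) * T 0 0) • backwardShift 1 := by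
  ext1 ψ
  ext1
  funext n
  change _ = ((s : ℂ)⁻¹ * R 0 0) • forwardShift 1 ψ n + V 0 0 • ψ n +
    ((s : ℂ) * T 0 0) • backwardShift 1 ψ n
  cases n <;> simp [scaledHalfLineToeplitz, halfLineAction, toEuclideanCLM_fin_one, mul_smul]

/-- `E` is in the spectrum of `H^s` exactly when the pencil of the two shifts at the transfer matrix
eigenvalues, divided by `s`, is not invertible: `E - H^s` is `-s t` times this pencil. -/
theorem mem_spectrum_scaledHalfLineToeplitz_iff (hT : T 0 0 ≠ 0) {E z w : ℂ}
    (hzw : (transferMatrix R V T E).charpoly = (X - C z) * (X - C w)) {s : ℝ} (hs : 0 < s) :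
    E ∈ spectrum ℂ (scaledHalfLineToeplitz R V T s) ↔
      ¬IsUnit (shiftPencil (forwardShift 1) (backwardShift 1) (z / s) (w / s)) := by
  obtain ⟨hadd, hmul⟩ := (charpoly_transferMatrix_eq_iff E z w).1 hzw
  have hs0 : (s : ℂ) ≠ 0 := by exact_mod_cast hs.ne'
  have hE : E = T 0 0 * (z + w) + V 0 0 := by
    rw [hadd]
    field_simp
    ring
  have hR : R 0 0 = T 0 0 * (z * w) := by
    rw [hmul]
    field_simp
  have hne : -((s : ℂ) * T 0 0) ≠ 0 := neg_ne_zero.2 (mul_ne_zero hs0 hT)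
  have e : algebraMap ℂ (HalfLine 1 →L[ℂ] HalfLine 1) E - scaledHalfLineToeplitz R V T s =
      Units.mk0 _ hne • shiftPencil (forwardShift 1) (backwardShift 1) (z / s) (w / s) := by
    rw [Units.smul_mk0, scaledHalfLineToeplitz_eq, Algebra.algebraMap_eq_smul_one, shiftPencil, hE,
      hR]
    match_scalars <;> field_simp
    ring
  rw [spectrum.mem_iff, e, isUnit_smul_iff]

end Scalar

end BlockToeplitz

open BlockToeplitz in
theorem mainTheorem12 (R V T : Matrix (Fin 1) (Fin 1) ℂ) (hR : IsUnit R) (hT : IsUnit T) :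
    BlockToeplitz.middleModulusSet R V T =
      ⋂ s ∈ Set.Ioi (0 : ℝ), spectrum ℂ (BlockToeplitz.scaledHalfLineToeplitz R V T s) := by
  have hT0 : T 0 0 ≠ 0 := by
    rw [Matrix.isUnit_iff_isUnit_det, Matrix.det_fin_one] at hT
    exact hT.ne_zero
  have hba := backwardShift_mul_forwardShift (L := 1)
  have ha := norm_forwardShift_le (L := 1)
  have hb := norm_backwardShift_le (L := 1)
  ext E
  simp only [Set.mem_iInter, Set.mem_Ioi, mem_middleModulusSet_iff]
  constructor
  · rintro ⟨z, w, h, hp⟩ s hs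
    rw [mem_spectrum_scaledHalfLineToeplitz_iff hT0 hp hs]
    exact not_isUnit_shiftPencil hba ha hb not_isUnit_backwardShift (by rw [norm_div, norm_div, h])
  · intro hE
    obtain ⟨z, w, hle, hp⟩ := exists_charpoly_transferMatrix_eq (R := R) (V := V) (T := T) E
    refine ⟨z, w, hle.eq_of_not_lt fun hlt => ?_, hp⟩
    obtain ⟨s, hzs, hsw⟩ := exists_between hlt
    have hs : 0 < s := (norm_nonneg z).trans_lt hzs
    refine (mem_spectrum_scaledHalfLineToeplitz_iff hT0 hp hs).1 (hE s hs) ?_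
    rw [shiftPencil_comm]
    refine isUnit_shiftPencil hba ha hb ?_ ?_
    · rwa [norm_div, Complex.norm_real, Real.norm_of_nonneg hs.le, one_lt_div hs]
    · rwa [norm_div, Complex.norm_real, Real.norm_of_nonneg hs.le, div_lt_one hs]
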